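/- Let $m \in \{1, 2, 5, 7, 8, 10, 11, 13, 14, 16, 17, 19, 22, 23\}$, let $n \ge 0$ be an integer, and fix a choice of the sign $\mp \in \{-,+\}$, used consistently below ($\pm$ denotes the opposite sign). Put $i = 1$ if $m$ is odd, $i = 4$ if $m \in \{8, 16\}$, and $i = 2$ for the other even $m$, and define the integer $\delta_m(n)$ by $$2(m + 24n)\bigl(62208n^{2} + (5184m \mp 432)n + (108m^{2} \mp 18m + 1)\bigr) = 2^{i}\delta_{m}(n).$$ Assume that $\delta_m(n)$ is squarefree. Let $A = 18(m+24n) \mp 1$, $B = \pm 4/9$, $D = -3$, $r = 1/3 + A^2$, $$H = \frac{2ABD + 2A^{2}Dr + 3r^{2}}{16}, \qquad J = \frac{B^{2}D + 2ABDr + A^{2}Dr^{2} + r^{3}}{64},$$ and let $E_{m,n}/\mathbb{Q}$ be the elliptic curve $y^2 + xy = x^3 + Hx + J$. For every positive squarefree integer $d \equiv 1 \pmod{12}$, the quadratic twist $$E_{m,n}^{(d)} \colon\ y^2 + xy = x^3 + \frac{d-1}{4}x^2 + H d^2 x + J d^3$$ of $E_{m,n}$ by $d$ has trivial rational torsion subgroup: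 $E_{m,n}^{(d)}(\mathbb{Q})_{\mathrm{tors}} = 0$. -/

import Mathlib

namespace TwistTorsion

/-- The quadratic twist `W^{(d)}` of a Weierstrass curve over a field of characteristic `≠ 2`.
It is the curve with `b₂' = d b₂`, `b₄' = d² b₄`, `b₆' = d³ b₆` and the same `a₁`, `a₃`; i.e. it is
the model with coefficients `a₁, a₃` of the curve `d Y² = 4 X³ + b₂ X² + 2 b₄ X + b₆`. -/
def quadraticTwist {K : Type*} [Field K] (W : WeierstrassCurve K) (d : K) : WeierstrassCurve K where
  a₁ := W.a₁
  a₂ := d * W.a₂ + W.a₁ ^ 2 * (d - 1) / 4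
  a₃ := W.a₃
  a₄ := d ^ 2 * W.a₄ + W.a₁ * W.a₃ * (d ^ 2 - 1) / 2
  a₆ := d ^ 3 * W.a₆ + W.a₃ ^ 2 * (d ^ 3 - 1) / 4

/-- For `y² = x³ + a x + b` a pair `(x, y)` lies on `d y² = x³ + a x + b` if and only if
`(d x, d² y)` lies on the twist. -/
theorem quadraticTwist_short {K : Type*} [Field K] (a b d : K) (hd : d ≠ 0) (x y : K) :
    (quadraticTwist (⟨0, 0, 0, a, b⟩ : WeierstrassCurve K) d).toAffine.Equation
      (d * x) (d ^ 2 * y) ↔ d * y ^ 2 = x ^ 3 + a * x + b := by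
  rw [WeierstrassCurve.Affine.equation_iff]
  simp only [quadraticTwist]
  have h3 : d ^ 3 ≠ 0 := pow_ne_zero 3 hd
  constructor
  · intro h
    apply mul_left_cancel₀ h3
    linear_combination h
  · intro h
    linear_combination d ^ 3 * h

/-- `W^{(d)}` becomes isomorphic to `W` over every extension containing a square root of `d`. -/
theorem quadraticTwist_iso {K L : Type*} [Field K] [Field L] (φ : K →+* L) (h2 : (2 : L) ≠ 0)
    (W : WeierstrassCurve K) (d : K) (hd : d ≠ 0) (σ : L) (hσ : σ ^ 2 = φ d) :
    ∃ C : WeierstrassCurve.VariableChange L, C • W.map φ = (quadraticTwist W d).map φ := by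
  have hσ0 : σ ≠ 0 := by
    rintro rfl
    exact hd ((map_eq_zero φ).mp (by rw [← hσ]; simp))
  have h4 : (4 : L) ≠ 0 := by
    have : (4 : L) = 2 * 2 := by norm_num
    rw [this]; exact mul_ne_zero h2 h2
  have hφ2 : φ 2 = 2 := map_ofNat φ 2
  have hφ4 : φ 4 = 4 := map_ofNat φ 4
  refine ⟨⟨(Units.mk0 σ hσ0)⁻¹, 0, (σ⁻¹ - 1) * φ W.a₁ / 2, (σ⁻¹ ^ 3 - 1) * φ W.a₃ / 2⟩, ?_⟩
  ext <;> simp [WeierstrassCurve.variableChange_def, quadraticTwist, ← hσ, hφ2, hφ4] <;> field_simp <;> ring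

/-! In what follows `s = ∓1` is the sign written `∓`, so that `±` is `-s`. -/

/-- `A = 18 (m + 24 n) ∓ 1`. -/
def A (s m n : ℤ) : ℚ := 18 * (m + 24 * n) + s

/-- `B = ± 4/9`. -/
def B (s : ℤ) : ℚ := -s * (4 / 9)

/-- `D = -3`. -/
def D : ℚ := -3

/-- `r = 1/3 + A²`. -/
def r (s m n : ℤ) : ℚ := 1 / 3 + A s m n ^ 2

/-- `H(m, n) = (2ABD + 2A²Dr + 3r²) / 16`. -/
def H (s m n : ℤ) : ℚ :=
  (2 * A s m n * B s * D + 2 * A s m n ^ 2 * D * r s m n + 3 * r s m n ^ 2) / 16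

/-- `J(m, n) = (B²D + 2ABDr + A²Dr² + r³) / 64`. -/
def J (s m n : ℤ) : ℚ :=
  (B s ^ 2 * D + 2 * A s m n * B s * D * r s m n + A s m n ^ 2 * D * r s m n ^ 2
    + r s m n ^ 3) / 64

/-- The curve `E_{m,n} : y² + x y = x³ + H(m, n) x + J(m, n)` over `ℚ`. -/
def E (s m n : ℤ) : WeierstrassCurve ℚ where
  a₁ := 1
  a₂ := 0
  a₃ := 0
  a₄ := H s m n
  a₆ := J s m n

/-- `2 (m + 24n) (62208 n² + (5184 m ∓ 432) n + (108 m² ∓ 18 m + 1))`. -/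
def poly (s m n : ℤ) : ℤ :=
  2 * (m + 24 * n) *
    (62208 * n ^ 2 + (5184 * m + s * 432) * n + (108 * m ^ 2 + s * 18 * m + 1))

/-- The exponent `i`: `1` for odd `m`, `4` for `m = 8, 16`, and `2` for the other even `m`. -/
def expo (m : ℤ) : ℕ := if Odd m then 1 else if m = 8 ∨ m = 16 then 4 else 2

/-- `n` is admissible for `m` and the chosen sign when `δ_m(n)`, defined by
`2 (m + 24n) (62208 n² + ⋯) = 2 ^ i δ_m(n)`, is a squarefree integer. -/
def Admissible (s m n : ℤ) : Prop :=
  ∃ δ : ℤ, poly s m n = 2 ^ expo m * δ ∧ Squarefree δ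

/-- The discriminant of `E_{m,n}` is `∓ 2 (m + 24n) (62208 n² + ⋯)`. -/
theorem E_Δ (s m n : ℤ) (hs : s = 1 ∨ s = -1) : (E s m n).Δ = s * poly s m n := by
  rcases hs with rfl | rfl <;>
  · simp only [WeierstrassCurve.Δ, WeierstrassCurve.b₂, WeierstrassCurve.b₄, WeierstrassCurve.b₆,
      WeierstrassCurve.b₈, E, H, J, r, A, B, D, poly]
    push_cast
    ring

/-- The twists of `E_{m,n}` are elliptic curves when `n` is admissible. -/
theorem isElliptic_twist (s m n : ℤ) (hs : s = 1 ∨ s = -1) (hn : Admissible s m n)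
    (d : ℚ) (hd : d ≠ 0) : (quadraticTwist (E s m n) d).IsElliptic := by
  have hΔ : (quadraticTwist (E s m n) d).Δ = d ^ 6 * (E s m n).Δ := by
    simp only [WeierstrassCurve.Δ, WeierstrassCurve.b₂, WeierstrassCurve.b₄, WeierstrassCurve.b₆,
      WeierstrassCurve.b₈, quadraticTwist]
    ring
  obtain ⟨δ, h1, h2⟩ := hn
  have hp : poly s m n ≠ 0 := by
    rw [h1]; exact mul_ne_zero (by positivity) h2.ne_zero
  have hs0 : s ≠ 0 := by rcases hs with rfl | rfl <;> norm_num
  refine ⟨?_⟩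
  rw [hΔ, E_Δ s m n hs]
  exact (mul_ne_zero (pow_ne_zero 6 hd)
    (mul_ne_zero (by exact_mod_cast hs0) (by exact_mod_cast hp))).isUnit

end TwistTorsion

namespace TwistTorsion

open WeierstrassCurve

/-! Reduction modulo `3` works without formal groups, through explicit formulas for doubling and
tripling. In the coordinate `z = 4x/d + r` the twist becomes, up to scaling, `y² = z³ - 3(Az + B)²`,
so rational points of order `2` or `3` force integer equations with no solution
(`ne_root_two_torsion`, `ne_root_three_torsion`). Hence doubles and triples of affine points are
affine. Modulo `3` the curve is `w² = x³ + x² + b₆` with `b₆ ≠ 0`, a group of order `6` or `3`,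
whose points of order `3` have `x = -b₆`. Tripling strictly increases `|x|₃` when `|x|₃ > 1`, so
torsion points are `3`-integral (`norm_le_one`). A torsion point cannot reduce to order `3`, as its
triple would be non-integral; orders `2` and `6` fall by doubling. -/

/-- The value of the `2`-division polynomial squared, `4x³ + b₂x² + 2b₄x + b₆`. -/
def twoDiv {R : Type*} [CommRing R] (b₂ b₄ b₆ x : R) : R :=
  4 * x ^ 3 + b₂ * x ^ 2 + 2 * b₄ * x + b₆

/-- The value of the `3`-division polynomial. -/
def threeDiv {R : Type*} [CommRing R] (b₂ b₄ b₆ b₈ x : R) : R :=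
  3 * x ^ 4 + b₂ * x ^ 3 + 3 * b₄ * x ^ 2 + 3 * b₆ * x + b₈

/-! ### Duplication and triplication formulas. -/

section Multiplication

variable {F : Type*} [Field F] {W : WeierstrassCurve F}

theorem sq_eq_twoDiv {x y : F} (h : W.toAffine.Equation x y) :
    (2 * y + W.a₁ * x + W.a₃) ^ 2 = twoDiv W.b₂ W.b₄ W.b₆ x := by
  rw [Affine.equation_iff] at h
  simp only [twoDiv, b₂, b₄, b₆]
  linear_combination 4 * h

theorem exists_double [DecidableEq F] {x y : F} (h : W.toAffine.Nonsingular x y)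
    (hw : 2 * y + W.a₁ * x + W.a₃ ≠ 0) :
    ∃ x₂ y₂ : F, ∃ h₂ : W.toAffine.Nonsingular x₂ y₂, ∃ l : F,
      Affine.Point.some x y h + Affine.Point.some x y h = Affine.Point.some x₂ y₂ h₂ ∧
      x₂ = l ^ 2 + W.a₁ * l - W.a₂ - x - x ∧
      y₂ = -(l * (x₂ - x) + y) - W.a₁ * x₂ - W.a₃ ∧
      (2 * l + W.a₁) * (2 * y + W.a₁ * x + W.a₃) = 6 * x ^ 2 + W.b₂ * x + W.b₄ ∧
      x₂ * twoDiv W.b₂ W.b₄ W.b₆ x =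
        x * twoDiv W.b₂ W.b₄ W.b₆ x - threeDiv W.b₂ W.b₄ W.b₆ W.b₈ x := by
  have hy : y ≠ W.toAffine.negY x y := by
    intro e
    apply hw
    rw [Affine.negY] at e
    linear_combination e
  have hl : W.toAffine.slope x x y y * (2 * y + W.a₁ * x + W.a₃) =
      3 * x ^ 2 + 2 * W.a₂ * x + W.a₄ - W.a₁ * y := by
    rw [Affine.slope_of_Y_ne rfl hy,
      show y - W.toAffine.negY x y = 2 * y + W.a₁ * x + W.a₃ by rw [Affine.negY]; ring,
      div_mul_cancel₀ _ hw]
  refine ⟨_, _, _, W.toAffine.slope x x y y, Affine.Point.add_self_of_Y_ne hy, rfl, rfl, ?_, ?_⟩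
  · simp only [b₂, b₄]
    linear_combination 2 * hl
  · have e := (Affine.equation_iff ..).mp h.1
    rw [← sq_eq_twoDiv h.1, Affine.addX]
    generalize W.toAffine.slope x x y y = l at hl ⊢
    have e2 : (l * (2 * y + W.a₁ * x + W.a₃)) ^ 2 = (3 * x ^ 2 + 2 * W.a₂ * x + W.a₄ - W.a₁ * y) ^ 2 := by
      rw [hl]
    simp only [threeDiv, b₂, b₄, b₆, b₈]
    linear_combination e2 + W.a₁ * (2 * y + W.a₁ * x + W.a₃) * hl -
      (12 * x + W.a₁ ^ 2 + 4 * W.a₂) * e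

theorem exists_triple [DecidableEq F] {x y : F} (h : W.toAffine.Nonsingular x y)
    (hw : 2 * y + W.a₁ * x + W.a₃ ≠ 0) (hψ : threeDiv W.b₂ W.b₄ W.b₆ W.b₈ x ≠ 0) :
    ∃ x₃ y₃ : F, ∃ h₃ : W.toAffine.Nonsingular x₃ y₃,
      3 • Affine.Point.some x y h = Affine.Point.some x₃ y₃ h₃ ∧
      x₃ * threeDiv W.b₂ W.b₄ W.b₆ W.b₈ x ^ 2 = x * threeDiv W.b₂ W.b₄ W.b₆ W.b₈ x ^ 2 +
        twoDiv W.b₂ W.b₄ W.b₆ x * (twoDiv W.b₂ W.b₄ W.b₆ x ^ 2 -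
          (6 * x ^ 2 + W.b₂ * x + W.b₄) * threeDiv W.b₂ W.b₄ W.b₆ W.b₈ x) := by
  obtain ⟨x₂, y₂, h₂, l, hadd, hx, hy, hl, hd⟩ := exists_double h hw
  rw [← sq_eq_twoDiv h.1] at hd ⊢
  generalize threeDiv W.b₂ W.b₄ W.b₆ W.b₈ x = ψ at *
  set w := 2 * y + W.a₁ * x + W.a₃ with hw_def
  have hd' : (x₂ - x) * w ^ 2 = -ψ := by linear_combination hd
  have hne : x₂ ≠ x := by
    rintro rfl
    apply hψ
    linear_combination hd'
  have hne' : x₂ - x ≠ 0 := sub_ne_zero.mpr hne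
  refine ⟨_, _, _, by rw [succ_nsmul, two_nsmul, hadd, Affine.Point.add_of_X_ne hne], ?_⟩
  rw [Affine.slope_of_X_ne hne, Affine.addX]
  -- The chord through `P` and `2P` has a slope expressible by the tangent slope `l` and `w ^ 3 /
  -- ψ`, which leaves `ψ ^ 2` as the only denominator of `x(3P)`.
  have hm : (y₂ - y) / (x₂ - x) = w ^ 3 / ψ - l - W.a₁ := by
    rw [div_eq_iff hne', ← sub_eq_zero]
    have : w ^ 3 / ψ * (x₂ - x) = - w := by
      rw [div_mul_eq_mul_div, div_eq_iff hψ]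
      linear_combination w * hd'
    rw [sub_mul, sub_mul, this, hy, hw_def]
    ring
  rw [hm, ← hl]
  generalize hτ : w ^ 3 / ψ = τ
  have hτ' : τ * ψ = w ^ 3 := by rw [← hτ, div_mul_cancel₀ _ hψ]
  rw [show (w ^ 2) * ((w ^ 2) ^ 2 - (2 * l + W.a₁) * w * ψ) =
    w ^ 3 * w ^ 3 - (2 * l + W.a₁) * w ^ 3 * ψ by ring, ← hτ']
  linear_combination -ψ ^ 2 * hx

end Multiplication

/-! ### 3-adic units and non-units. -/

theorem norm_eq_one_of_toZMod_ne_zero {p : ℕ} [Fact p.Prime] {z : ℤ_[p]}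
    (h : PadicInt.toZMod z ≠ 0) : ‖z‖ = 1 := by
  by_contra hz
  apply h
  rw [← RingHom.mem_ker, PadicInt.ker_toZMod]
  exact PadicInt.mem_nonunits.mpr (lt_of_le_of_ne (PadicInt.norm_le_one z) hz)

theorem toZMod_eq_zero_iff_norm_lt_one {p : ℕ} [Fact p.Prime] {z : ℤ_[p]} :
    PadicInt.toZMod z = 0 ↔ ‖z‖ < 1 := by
  rw [← RingHom.mem_ker, PadicInt.ker_toZMod]
  exact PadicInt.mem_nonunits

theorem coe_padicInt_ofNat {p : ℕ} [Fact p.Prime] (n : ℕ) [n.AtLeastTwo] :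
    ((no_index (OfNat.ofNat n : ℤ_[p])) : ℚ_[p]) = OfNat.ofNat n :=
  map_ofNat PadicInt.Coe.ringHom n

/-- An element whose product with a nonzero non-unit is a unit is not integral. -/
theorem one_lt_norm_of_mul_eq {p : ℕ} [Fact p.Prime] {a : ℚ_[p]} {q v : ℤ_[p]}
    (hq : PadicInt.toZMod q = 0) (hv : PadicInt.toZMod v ≠ 0) (h : a * q = v) : 1 < ‖a‖ := by
  have hq' : ‖(q : ℚ_[p])‖ < 1 := toZMod_eq_zero_iff_norm_lt_one.mp hq
  have hv' : ‖(v : ℚ_[p])‖ = 1 := norm_eq_one_of_toZMod_ne_zero hv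
  have e : ‖a‖ * ‖(q : ℚ_[p])‖ = 1 := by rw [← norm_mul, h, hv']
  by_contra! ha
  nlinarith [norm_nonneg a, norm_nonneg (q : ℚ_[p])]

/-! ### Torsion and reduction modulo 3. -/

/-- `W` is `3`-integral with `b₂ ≡ 1`, `b₄ ≡ 0` and `b₆ ≡ b₈ ≢ 0` modulo `3`, and it has no
rational point of order `2` or `3`. -/
structure GoodAtThree (W : WeierstrassCurve ℚ) where
  β₂ : ℤ_[3]
  β₄ : ℤ_[3]
  β₆ : ℤ_[3]
  β₈ : ℤ_[3]
  coe_β₂ : (β₂ : ℚ_[3]) = (W.b₂ : ℚ)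
  coe_β₄ : (β₄ : ℚ_[3]) = (W.b₄ : ℚ)
  coe_β₆ : (β₆ : ℚ_[3]) = (W.b₆ : ℚ)
  coe_β₈ : (β₈ : ℚ_[3]) = (W.b₈ : ℚ)
  toZMod_β₂ : PadicInt.toZMod β₂ = 1
  toZMod_β₄ : PadicInt.toZMod β₄ = 0
  toZMod_β₆ : PadicInt.toZMod β₆ ≠ 0
  toZMod_β₈ : PadicInt.toZMod β₈ = PadicInt.toZMod β₆
  twoDiv_ne_zero : ∀ x y : ℚ, W.toAffine.Nonsingular x y → 2 * y + W.a₁ * x + W.a₃ ≠ 0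
  threeDiv_ne_zero : ∀ x y : ℚ, W.toAffine.Nonsingular x y →
    threeDiv W.b₂ W.b₄ W.b₆ W.b₈ x ≠ 0

namespace GoodAtThree

variable {W : WeierstrassCurve ℚ}

theorem exists_triple_padic (g : GoodAtThree W) {x y : ℚ} (h : W.toAffine.Nonsingular x y) :
    ∃ x₃ y₃ : ℚ, ∃ h₃ : W.toAffine.Nonsingular x₃ y₃,
      3 • Affine.Point.some x y h = Affine.Point.some x₃ y₃ h₃ ∧
      ((x₃ : ℚ) : ℚ_[3]) * threeDiv (g.β₂ : ℚ_[3]) g.β₄ g.β₆ g.β₈ (x : ℚ) ^ 2 =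
        (x : ℚ) * threeDiv (g.β₂ : ℚ_[3]) g.β₄ g.β₆ g.β₈ (x : ℚ) ^ 2 +
        twoDiv (g.β₂ : ℚ_[3]) g.β₄ g.β₆ (x : ℚ) * (twoDiv (g.β₂ : ℚ_[3]) g.β₄ g.β₆ (x : ℚ) ^ 2 -
          (6 * (x : ℚ) ^ 2 + (g.β₂ : ℚ_[3]) * (x : ℚ) + g.β₄) *
            threeDiv (g.β₂ : ℚ_[3]) g.β₄ g.β₆ g.β₈ (x : ℚ)) := by
  obtain ⟨x₃, y₃, h₃, e, he⟩ :=
    exists_triple h (g.twoDiv_ne_zero x y h) (g.threeDiv_ne_zero x y h)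
  refine ⟨x₃, y₃, h₃, e, ?_⟩
  rw [g.coe_β₂, g.coe_β₄, g.coe_β₆, g.coe_β₈]
  simp only [threeDiv, twoDiv] at he ⊢
  exact_mod_cast he

/-- In the kernel of reduction, tripling moves a point strictly closer to zero. -/
theorem norm_lt_norm_triple (g : GoodAtThree W) {x y : ℚ} (h : W.toAffine.Nonsingular x y)
    (hx : 1 < ‖(x : ℚ_[3])‖) :
    ∃ x₃ y₃ : ℚ, ∃ h₃ : W.toAffine.Nonsingular x₃ y₃,
      3 • Affine.Point.some x y h = Affine.Point.some x₃ y₃ h₃ ∧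
      ‖(x : ℚ_[3])‖ < ‖(x₃ : ℚ_[3])‖ := by
  obtain ⟨x₃, y₃, h₃, e, he⟩ := g.exists_triple_padic h
  refine ⟨x₃, y₃, h₃, e, ?_⟩
  generalize (x : ℚ_[3]) = X at *
  generalize (x₃ : ℚ_[3]) = X₃ at *
  have hX : X ≠ 0 := by rintro rfl; norm_num at hx
  have hu : ‖X⁻¹‖ < 1 := by rw [norm_inv]; exact inv_lt_one_of_one_lt₀ hx
  obtain ⟨u, hu'⟩ : ∃ u : ℤ_[3], (u : ℚ_[3]) = X⁻¹ := ⟨⟨X⁻¹, hu.le⟩, rfl⟩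
  have hu0 : PadicInt.toZMod u = 0 :=
    toZMod_eq_zero_iff_norm_lt_one.mpr (by rwa [PadicInt.norm_def, hu'])
  have hXu : X * u = 1 := by rw [hu', mul_inv_cancel₀ hX]
  -- `P`, `T`, `G` are the division polynomials and `6x² + b₂x + b₄`, rewritten in `u = 1/X`. Modulo
  -- `3` only the leading coefficients `3`, `4`, `6` survive.
  set P : ℤ_[3] := 3 + g.β₂ * u + 3 * g.β₄ * u ^ 2 + 3 * g.β₆ * u ^ 3 + g.β₈ * u ^ 4 with hP
  set T : ℤ_[3] := 4 + g.β₂ * u + 2 * g.β₄ * u ^ 2 + g.β₆ * u ^ 3 with hT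
  set G : ℤ_[3] := 6 + g.β₂ * u + g.β₄ * u ^ 2 with hG
  have hP0 : PadicInt.toZMod P = 0 := by
    simp only [hP, map_add, map_mul, map_pow, map_ofNat, hu0]
    generalize PadicInt.toZMod g.β₂ = b₂
    generalize PadicInt.toZMod g.β₄ = b₄
    revert b₂ b₄; generalize PadicInt.toZMod g.β₆ = b₆; generalize PadicInt.toZMod g.β₈ = b₈
    revert b₆ b₈; decide
  have hT0 : PadicInt.toZMod T = 1 := by
    simp only [hT, map_add, map_mul, map_pow, map_ofNat, hu0]
    generalize PadicInt.toZMod g.β₂ = b₂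
    generalize PadicInt.toZMod g.β₄ = b₄
    revert b₂ b₄; generalize PadicInt.toZMod g.β₆ = b₆; generalize PadicInt.toZMod g.β₈ = b₈
    revert b₆ b₈; decide
  have hG0 : PadicInt.toZMod G = 0 := by
    simp only [hG, map_add, map_mul, map_pow, map_ofNat, hu0]
    generalize PadicInt.toZMod g.β₂ = b₂
    generalize PadicInt.toZMod g.β₄ = b₄
    revert b₂ b₄; generalize PadicInt.toZMod g.β₆ = b₆; generalize PadicInt.toZMod g.β₈ = b₈
    revert b₆ b₈; decide
  have eP : threeDiv (g.β₂ : ℚ_[3]) g.β₄ g.β₆ g.β₈ X = X ^ 4 * P := by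
    rw [hP]; push_cast [coe_padicInt_ofNat]; rw [hu', threeDiv]; field_simp
  have eT : twoDiv (g.β₂ : ℚ_[3]) g.β₄ g.β₆ X = X ^ 3 * T := by
    rw [hT]; push_cast [coe_padicInt_ofNat]; rw [hu', twoDiv]; field_simp
  have eG : 6 * X ^ 2 + (g.β₂ : ℚ_[3]) * X + g.β₄ = X ^ 2 * G := by
    rw [hG]; push_cast [coe_padicInt_ofNat]; rw [hu']; field_simp
  rw [eP, eT, eG] at he
  -- The right side is `≡ T³ ≡ 1` while `P ≡ 0`, so `X₃ / X` is not integral.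
  have key : (X₃ * u) * (P ^ 2 : ℤ_[3]) = ((P ^ 2 + T * (T ^ 2 - G * P) : ℤ_[3]) : ℚ_[3]) := by
    apply mul_left_cancel₀ (pow_ne_zero 9 hX)
    push_cast
    linear_combination he + (X ^ 8 * X₃ * P ^ 2) * hXu
  have := one_lt_norm_of_mul_eq (by simp [hP0]) (by simp [hP0, hT0]) key
  rw [norm_mul, hu', norm_inv, ← div_eq_mul_inv, one_lt_div (by linarith)] at this
  exact this

/-- A finite subgroup has a point with maximal `|x|₃`; if this exceeds `1`, tripling contradicts
maximality. -/
theorem norm_le_one (g : GoodAtThree W) {x y : ℚ} (h : W.toAffine.Nonsingular x y)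
    (hf : IsOfFinAddOrder (Affine.Point.some x y h)) : ‖(x : ℚ_[3])‖ ≤ 1 := by
  by_contra! hx
  let S : Set W.toAffine.Point := AddSubgroup.zmultiples (Affine.Point.some x y h)
  have hS : S.Finite := hf.finite_zmultiples
  let T : Set ℝ := {t | ∃ x y : ℚ, ∃ h : W.toAffine.Nonsingular x y,
    Affine.Point.some x y h ∈ S ∧ 1 < ‖(x : ℚ_[3])‖ ∧ t = ‖(x : ℚ_[3])‖}
  let size : W.toAffine.Point → ℝ := fun P => match P with
    | .zero => 0
    | .some x _ _ => ‖(x : ℚ_[3])‖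
  have hT : T.Finite := by
    refine (hS.image size).subset ?_
    rintro _ ⟨x, y, h, hm, -, rfl⟩
    exact ⟨_, hm, rfl⟩
  obtain ⟨_, ⟨⟨x', y', h', hm, hx', rfl⟩, hmax⟩⟩ :=
    hT.exists_maximal ⟨_, x, y, h, AddSubgroup.mem_zmultiples _, hx, rfl⟩
  obtain ⟨x₃, y₃, h₃, e, hlt⟩ := g.norm_lt_norm_triple h' hx'
  refine absurd (hmax ⟨x₃, y₃, h₃, ?_, hx'.trans hlt, rfl⟩ hlt.le) (not_le.mpr hlt)
  rw [← e]
  exact AddSubgroup.nsmul_mem _ hm 3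

/-- Modulo `3` the `3`-division polynomial is `x³ + b₆`, with only root `-b₆`. There its numerator
partner `f` is a unit, so the triple would be a torsion point with non-integral `x`. -/
theorem torsion_residue_ne (g : GoodAtThree W) {x y : ℚ} (h : W.toAffine.Nonsingular x y)
    (hf : IsOfFinAddOrder (Affine.Point.some x y h)) (ξ : ℤ_[3]) (hξ : (ξ : ℚ_[3]) = x) :
    PadicInt.toZMod ξ ≠ -PadicInt.toZMod g.β₆ := by
  intro hr
  obtain ⟨x₃, y₃, h₃, e, he⟩ := g.exists_triple_padic h
  rw [← hξ] at he
  set f : ℤ_[3] := twoDiv g.β₂ g.β₄ g.β₆ ξ with hfd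
  set ψ : ℤ_[3] := threeDiv g.β₂ g.β₄ g.β₆ g.β₈ ξ with hψd
  have h6 := g.toZMod_β₆
  have hf0 : PadicInt.toZMod f = 1 := by
    simp only [hfd, twoDiv, map_add, map_mul, map_pow, map_ofNat, hr, g.toZMod_β₂, g.toZMod_β₄]
    generalize PadicInt.toZMod g.β₆ = b at h6 ⊢
    revert b; decide
  have hψ0 : PadicInt.toZMod ψ = 0 := by
    simp only [hψd, threeDiv, map_add, map_mul, map_pow, map_ofNat, hr, g.toZMod_β₂, g.toZMod_β₄,
      g.toZMod_β₈]
    generalize PadicInt.toZMod g.β₆ = b at h6 ⊢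
    revert b; decide
  have key : (x₃ : ℚ_[3]) * (ψ ^ 2 : ℤ_[3]) =
      ((ξ * ψ ^ 2 + f * (f ^ 2 - (6 * ξ ^ 2 + g.β₂ * ξ + g.β₄) * ψ) : ℤ_[3]) : ℚ_[3]) := by
    simp only [hfd, hψd, twoDiv, threeDiv] at he ⊢
    push_cast [coe_padicInt_ofNat]
    exact he
  have h1 := one_lt_norm_of_mul_eq (by simp [hψ0]) (by simp [hψ0, hf0]) key
  have h2 : IsOfFinAddOrder (Affine.Point.some x₃ y₃ h₃) := e ▸ hf.nsmul
  exact absurd (g.norm_le_one h₃ h2) (not_le.mpr h1)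

theorem torsion_eq_bot (g : GoodAtThree W) : AddCommGroup.torsion W.toAffine.Point = ⊥ := by
  rw [eq_bot_iff]
  rintro (_ | ⟨x, y, h⟩) hP
  · exact AddSubgroup.mem_bot.mpr rfl
  exfalso
  have hf : IsOfFinAddOrder (Affine.Point.some x y h) := hP
  obtain ⟨ξ, hξ⟩ : ∃ ξ : ℤ_[3], (ξ : ℚ_[3]) = x := ⟨⟨x, g.norm_le_one h hf⟩, rfl⟩
  have hr := g.torsion_residue_ne h hf ξ hξ
  have hw : ((2 * y + W.a₁ * x + W.a₃ : ℚ) : ℚ_[3]) ^ 2 =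
      (twoDiv g.β₂ g.β₄ g.β₆ ξ : ℤ_[3]) := by
    have := congrArg ((↑) : ℚ → ℚ_[3]) (sq_eq_twoDiv h.1)
    simp only [twoDiv] at this ⊢
    push_cast [coe_padicInt_ofNat] at this ⊢
    rw [g.coe_β₂, g.coe_β₄, g.coe_β₆, hξ]
    exact this
  generalize ((2 * y + W.a₁ * x + W.a₃ : ℚ) : ℚ_[3]) = w at hw
  have hw1 : ‖w‖ ≤ 1 := by
    have := PadicInt.norm_le_one (twoDiv g.β₂ g.β₄ g.β₆ ξ)
    rw [PadicInt.norm_def, ← hw, norm_pow] at this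
    exact (pow_le_one_iff_of_nonneg (norm_nonneg _) two_ne_zero).mp this
  obtain ⟨ω, rfl⟩ : ∃ ω : ℤ_[3], (ω : ℚ_[3]) = w := ⟨⟨w, hw1⟩, rfl⟩
  have hw' : ω ^ 2 = twoDiv g.β₂ g.β₄ g.β₆ ξ := PadicInt.ext (by rw [PadicInt.coe_pow, hw])
  have hw3 := congrArg PadicInt.toZMod hw'
  obtain ⟨x₂, y₂, h₂, -, e, -, -, -, hd⟩ := exists_double h (g.twoDiv_ne_zero x y h)
  have h2 : IsOfFinAddOrder (Affine.Point.some x₂ y₂ h₂) := by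
    rw [← e, ← two_nsmul]; exact hf.nsmul
  obtain ⟨ξ₂, hξ₂⟩ : ∃ ξ : ℤ_[3], (ξ : ℚ_[3]) = x₂ := ⟨⟨x₂, g.norm_le_one h₂ h2⟩, rfl⟩
  have hr₂ := g.torsion_residue_ne h₂ h2 ξ₂ hξ₂
  have hd' : ξ₂ * twoDiv g.β₂ g.β₄ g.β₆ ξ =
      ξ * twoDiv g.β₂ g.β₄ g.β₆ ξ - threeDiv g.β₂ g.β₄ g.β₆ g.β₈ ξ := by
    apply PadicInt.ext
    simp only [twoDiv, threeDiv] at hd ⊢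
    push_cast [coe_padicInt_ofNat]
    rw [g.coe_β₂, g.coe_β₄, g.coe_β₆, g.coe_β₈, hξ, hξ₂]
    exact_mod_cast hd
  have hd3 := congrArg PadicInt.toZMod hd'
  have h6 := g.toZMod_β₆
  simp only [twoDiv, threeDiv, map_add, map_sub, map_mul, map_pow, map_ofNat, g.toZMod_β₂,
    g.toZMod_β₄, g.toZMod_β₈] at hd3 hw3
  generalize PadicInt.toZMod g.β₆ = b at *
  generalize PadicInt.toZMod ξ = a at *
  generalize PadicInt.toZMod ξ₂ = c at *
  generalize PadicInt.toZMod ω = t at *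
  -- For `b = 2`, the only `a` making the cubic a square is `-b`. For `b = 1`: `a = 2` is `-b`; `a =
  -- 1` (order `2`) violates the duplication formula; `a = 0` (order `6`) doubles to `c = -b`.
  clear * - hd3 hw3 hr hr₂ h6
  revert a b c t
  decide

end GoodAtThree

/-! ### No rational points of order 2 or 3. -/

theorem exists_int_eq_of_cubic {p : ℚ} (a b c : ℤ) (h : p ^ 3 + a * p ^ 2 + b * p + c = 0) :
    ∃ k : ℤ, (k : ℚ) = p := by
  have : IsIntegral ℤ p := by
    refine ⟨Polynomial.X ^ 3 + Polynomial.C a * Polynomial.X ^ 2 + Polynomial.C b * Polynomial.X +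
      Polynomial.C c, by monicity!, ?_⟩
    rw [← Polynomial.aeval_def]
    simp only [map_add, map_mul, map_pow, Polynomial.aeval_X, Polynomial.aeval_C]
    simpa using h
  exact IsIntegrallyClosed.isIntegral_iff.mp this

theorem ne_root_two_torsion {s a : ℤ} (hs : s = 1 ∨ s = -1) (ha : 3 ≤ a) (z : ℚ) :
    z ^ 3 ≠ 3 * (a * z + B s) ^ 2 := by
  intro h
  have hs2 : (s : ℚ) ^ 2 = 1 := by rcases hs with rfl | rfl <;> norm_num
  have hz : z ≠ 0 := by
    rintro rfl
    simp only [B] at h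
    nlinarith
  -- With `p = -3B/z = 4s/(3z)` the equation becomes the monic integral `p(3a - p)² = 4s`. An
  -- integer `p` divides `4`, whereas `3a - p ≥ 5`.
  have hp : (4 * s / (3 * z) : ℚ) ^ 3 + (-(6 * a) : ℤ) * (4 * s / (3 * z)) ^ 2 +
      (9 * a ^ 2 : ℤ) * (4 * s / (3 * z)) + (-(4 * s) : ℤ) = 0 := by
    simp only [B] at h
    push_cast
    field_simp
    linear_combination -108 * s * h
  obtain ⟨k, hk⟩ := exists_int_eq_of_cubic _ _ _ hp
  rw [← hk] at hp
  have hk' : k * (3 * a - k) ^ 2 = 4 * s := by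
    have : (k * (3 * a - k) ^ 2 : ℚ) = 4 * s := by push_cast at hp; linear_combination hp
    exact_mod_cast this
  have hk4 : |k| ≤ 4 := by
    have : k ∣ 4 := by
      rcases hs with rfl | rfl
      · exact ⟨(3 * a - k) ^ 2, by linear_combination -hk'⟩
      · exact ⟨-(3 * a - k) ^ 2, by linear_combination hk'⟩
    exact Int.le_of_dvd (by norm_num) ((abs_dvd _ _).mpr this)
  have hk0 : k ≠ 0 := by rintro rfl; omega
  obtain ⟨h1, h2⟩ := abs_le.mp hk4
  have h5 : 25 ≤ (3 * a - k) ^ 2 := by nlinarith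
  rcases lt_or_gt_of_ne hk0 with h0 | h0 <;> rcases hs with rfl | rfl <;> nlinarith

theorem ne_root_three_torsion {s a : ℤ} (hs : s = 1 ∨ s = -1) (ha : 3 ≤ a) {z : ℚ} (hz : z ≠ 0) :
    -- Completing the cube gives `(a + 3B/z)³ = a³ + 9B/4 = a³ - s`, but no integer cube is adjacent
    -- to `a³` when `a ≥ 3`.
    z ^ 3 ≠ 4 * (a ^ 2 * z ^ 2 + 3 * a * B s * z + 3 * B s ^ 2) := by
  intro h
  have hc : (a + 3 * B s / z) ^ 3 + (0 : ℤ) * (a + 3 * B s / z) ^ 2 + (0 : ℤ) * (a + 3 * B s / z) +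
      (s - a ^ 3 : ℤ) = 0 := by
    simp only [B] at h ⊢
    push_cast
    field_simp
    linear_combination 729 * s * h
  obtain ⟨k, hk⟩ := exists_int_eq_of_cubic _ _ _ hc
  rw [← hk] at hc
  have hk' : k ^ 3 = a ^ 3 - s := by
    have : (k ^ 3 : ℚ) = a ^ 3 - s := by push_cast at hc; linear_combination hc
    exact_mod_cast this
  have hmono : StrictMono fun t : ℤ => t ^ 3 := Odd.strictMono_pow (by decide)
  rcases hs with rfl | rfl
  · have h1 : a - 1 < k := hmono.lt_iff_lt.mp (by show (a - 1) ^ 3 < k ^ 3; nlinarith)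
    have h2 : k < a := hmono.lt_iff_lt.mp (by show k ^ 3 < a ^ 3; omega)
    omega
  · have h1 : a < k := hmono.lt_iff_lt.mp (by show a ^ 3 < k ^ 3; omega)
    have h2 : k < a + 1 := hmono.lt_iff_lt.mp (by show k ^ 3 < (a + 1) ^ 3; nlinarith)
    omega

/-! ### The twists and their invariants modulo 3. -/

theorem twoDiv_twist (s m n : ℤ) (d x : ℚ) (hd : d ≠ 0) :
    16 * twoDiv (quadraticTwist (E s m n) d).b₂ (quadraticTwist (E s m n) d).b₄
      (quadraticTwist (E s m n) d).b₆ x =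
    d ^ 3 * ((4 * x / d + r s m n) ^ 3 -
      3 * (A s m n * (4 * x / d + r s m n) + B s) ^ 2) := by
  simp only [twoDiv, b₂, b₄, b₆, quadraticTwist, E, H, J, r, D]
  generalize A s m n = a
  generalize B s = b
  field_simp
  ring

theorem threeDiv_twist (s m n : ℤ) (d x : ℚ) (hd : d ≠ 0) :
    256 * threeDiv (quadraticTwist (E s m n) d).b₂ (quadraticTwist (E s m n) d).b₄
      (quadraticTwist (E s m n) d).b₆ (quadraticTwist (E s m n) d).b₈ x =
    3 * d ^ 4 * ((4 * x / d + r s m n) * ((4 * x / d + r s m n) ^ 3 -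
      4 * (A s m n ^ 2 * (4 * x / d + r s m n) ^ 2 +
        3 * A s m n * B s * (4 * x / d + r s m n) + 3 * B s ^ 2))) := by
  simp only [threeDiv, b₂, b₄, b₆, b₈, quadraticTwist, E, H, J, r, D]
  generalize A s m n = a
  generalize B s = b
  field_simp
  ring

theorem b₄_twist {s m n : ℤ} (hs : s = 1 ∨ s = -1) (d : ℚ) :
    8 * (quadraticTwist (E s m n) d).b₄ =
      d ^ 2 * (48 * (s * (m + 24 * n)) + 3 - 3 * (18 * (s * (m + 24 * n)) + 1) ^ 4) := by
  rcases hs with rfl | rfl <;>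
  · simp only [b₄, quadraticTwist, E, H, r, A, B, D]
    push_cast
    ring

/-- The form exhibits `b₆ ≡ d³ s(m + 24n)` modulo `3`, a unit when `3` divides neither `m` nor `d`.
-/
theorem b₆_twist {s m n : ℤ} (hs : s = 1 ∨ s = -1) (d : ℚ) :
    16 * (quadraticTwist (E s m n) d).b₆ =
      d ^ 3 * (s * (m + 24 * n) - 3 * (43 * (s * (m + 24 * n)) + 3024 * (s * (m + 24 * n)) ^ 2
        + 80352 * (s * (m + 24 * n)) ^ 3 + 1084752 * (s * (m + 24 * n)) ^ 4
        + 7558272 * (s * (m + 24 * n)) ^ 5 + 22674816 * (s * (m + 24 * n)) ^ 6)) := by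
  rcases hs with rfl | rfl <;>
  · simp only [b₆, quadraticTwist, E, J, r, A, B, D]
    push_cast
    ring

theorem exists_padicInt_eq {k z : ℤ} {q : ℚ} (hk : ¬ (3 : ℤ) ∣ k) (h : k * q = z) :
    ∃ β : ℤ_[3], (β : ℚ_[3]) = q := by
  refine ⟨⟨q, ?_⟩, rfl⟩
  have h1 : ‖((k : ℤ) : ℚ_[3])‖ = 1 :=
    le_antisymm (Padic.norm_int_le_one k) (not_lt.mp (mt Padic.norm_intCast_lt_one_iff.mp hk))
  have h2 : ((k : ℤ) : ℚ_[3]) * (q : ℚ_[3]) = (z : ℤ) := by exact_mod_cast congrArg ((↑) : ℚ → ℚ_[3]) h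
  have h3 := congrArg norm h2
  rw [norm_mul, h1, one_mul] at h3
  rw [h3]
  exact Padic.norm_int_le_one z

theorem nonempty_goodAtThree {s m n d : ℤ} (hs : s = 1 ∨ s = -1) (hpos : 0 < m + 24 * n)
    (h3 : ¬ (3 : ℤ) ∣ m) (hd0 : 0 < d) (hd3 : d ≡ 1 [ZMOD 3]) :
    Nonempty (GoodAtThree (quadraticTwist (E s m n) (d : ℚ))) := by
  have hdq : (0 : ℚ) < d := by exact_mod_cast hd0
  have hA : A s m n = ((18 * (m + 24 * n) + s : ℤ) : ℚ) := by rw [A]; push_cast; ring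
  have ha : 3 ≤ 18 * (m + 24 * n) + s := by omega
  have hf : ∀ x, twoDiv (quadraticTwist (E s m n) (d : ℚ)).b₂ (quadraticTwist (E s m n) (d : ℚ)).b₄
      (quadraticTwist (E s m n) (d : ℚ)).b₆ x ≠ 0 := by
    intro x hx
    have := twoDiv_twist s m n d x hdq.ne'
    rw [hx, mul_zero, eq_comm, mul_eq_zero, or_iff_right (by positivity), sub_eq_zero, hA] at this
    exact ne_root_two_torsion hs ha _ this
  have e2 : (quadraticTwist (E s m n) (d : ℚ)).b₂ = d := by
    simp only [b₂, quadraticTwist, E]; ring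
  have e4 := b₄_twist (m := m) (n := n) hs (d : ℚ)
  have e6 := b₆_twist (m := m) (n := n) hs (d : ℚ)
  have e8 := (quadraticTwist (E s m n) (d : ℚ)).b_relation
  have hd1 : ((d : ℤ) : ZMod 3) = 1 := by
    have := (ZMod.intCast_eq_intCast_iff d 1 3).mpr hd3
    simpa using this
  set t : ℤ := s * (m + 24 * n) with ht
  have ht0 : ((t : ℤ) : ZMod 3) ≠ 0 := by
    rw [Ne, ZMod.intCast_zmod_eq_zero_iff_dvd]
    push_cast
    rcases hs with rfl | rfl <;> omega
  set h4 : ℤ := d ^ 2 * (48 * t + 3 - 3 * (18 * t + 1) ^ 4) with hh4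
  set h6 : ℤ := d ^ 3 * (t - 3 * (43 * t + 3024 * t ^ 2 + 80352 * t ^ 3 + 1084752 * t ^ 4
    + 7558272 * t ^ 5 + 22674816 * t ^ 6)) with hh6
  have e4' : ((8 : ℤ) : ℚ) * (quadraticTwist (E s m n) (d : ℚ)).b₄ = (h4 : ℤ) := by
    rw [hh4, ht]; push_cast; exact e4
  have e6' : ((16 : ℤ) : ℚ) * (quadraticTwist (E s m n) (d : ℚ)).b₆ = (h6 : ℤ) := by
    rw [hh6, ht]; push_cast; exact e6
  -- From `4b₈ = b₂b₆ - b₄²`, which also yields `b₈ ≡ b₆` modulo `3`, since `b₂ ≡ 1` and `b₄ ≡ 0`.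
  have e8' : ((256 : ℤ) : ℚ) * (quadraticTwist (E s m n) (d : ℚ)).b₈ =
      ((4 * d * h6 - h4 ^ 2 : ℤ) : ℚ) := by
    rw [e2] at e8
    push_cast
    rw [← e4', ← e6']
    push_cast
    linear_combination 64 * e8
  have key {k z : ℤ} {q : ℚ} {β : ℤ_[3]} (hβ : (β : ℚ_[3]) = q) (h : k * q = z) :
      (k : ZMod 3) * PadicInt.toZMod β = z := by
    have h2 : ((k : ℤ) : ℚ_[3]) * (q : ℚ_[3]) = (z : ℤ) := by
      exact_mod_cast congrArg ((↑) : ℚ → ℚ_[3]) h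
    rw [← hβ] at h2
    have : (k : ℤ_[3]) * β = z := PadicInt.ext (by push_cast; exact h2)
    simpa using congrArg PadicInt.toZMod this
  obtain ⟨β₄, c4⟩ := exists_padicInt_eq (by norm_num) e4'
  obtain ⟨β₆, c6⟩ := exists_padicInt_eq (by norm_num) e6'
  obtain ⟨β₈, c8⟩ := exists_padicInt_eq (by norm_num) e8'
  have k4 := key c4 e4'
  have k6 := key c6 e6'
  have k8 := key c8 e8'
  have h40 : ((h4 : ℤ) : ZMod 3) = 0 := by
    rw [ZMod.intCast_zmod_eq_zero_iff_dvd]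
    exact Dvd.dvd.mul_left ⟨16 * t + 1 - (18 * t + 1) ^ 4, by push_cast; ring⟩ _
  have h6t : ((h6 : ℤ) : ZMod 3) = t := by
    rw [hh6]
    push_cast
    rw [hd1, show (3 : ZMod 3) = 0 from rfl]
    ring
  push_cast at k8
  rw [h40, hd1, ← k6] at k8
  rw [h40] at k4
  have h60 : PadicInt.toZMod β₆ ≠ 0 := by
    intro h
    rw [h, mul_zero, h6t] at k6
    exact ht0 k6.symm
  refine ⟨⟨d, β₄, β₆, β₈, by rw [e2]; norm_cast, c4, c6, c8, by simpa using hd1, ?_, h60, ?_, ?_, ?_⟩⟩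
  · generalize PadicInt.toZMod β₄ = b at k4 ⊢
    revert b; decide
  · push_cast at k8
    generalize PadicInt.toZMod β₆ = b at k8 ⊢
    generalize PadicInt.toZMod β₈ = c at k8 ⊢
    revert b c; decide
  · intro x y h hw
    have := sq_eq_twoDiv h.1
    rw [hw] at this
    exact hf x (by rw [← this]; ring)
  · intro x y h hψ
    have e := threeDiv_twist s m n d x hdq.ne'
    rw [hψ, mul_zero, eq_comm, mul_eq_zero, or_iff_right (by positivity), mul_eq_zero] at e
    rcases e with e | e
    · have e' := twoDiv_twist s m n d x hdq.ne'
      rw [e, ← sq_eq_twoDiv h.1] at e'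
      have hB : 0 < B s ^ 2 := by rcases hs with rfl | rfl <;> norm_num [B]
      have : 0 < (d : ℚ) ^ 3 * B s ^ 2 := by positivity
      nlinarith [sq_nonneg (2 * y + (quadraticTwist (E s m n) (d : ℚ)).a₁ * x +
        (quadraticTwist (E s m n) (d : ℚ)).a₃)]
    · by_cases hz : 4 * x / d + r s m n = 0
      · rw [hz] at e
        have hB : 0 < B s ^ 2 := by rcases hs with rfl | rfl <;> norm_num [B]
        nlinarith
      · rw [sub_eq_zero, hA] at e
        exact ne_root_three_torsion hs ha hz e

end TwistTorsion

theorem proposition3p6 (s m n d : ℤ) (hs : s = 1 ∨ s = -1)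
    (hm : m ∈ ({1, 2, 5, 7, 8, 10, 11, 13, 14, 16, 17, 19, 22, 23} : Set ℤ))
    (hn0 : 0 ≤ n) (hn : TwistTorsion.Admissible s m n)
    (hd0 : 0 < d) (hd : Squarefree d) (hd12 : d ≡ 1 [ZMOD 12]) :
    AddCommGroup.torsion
      (TwistTorsion.quadraticTwist (TwistTorsion.E s m n) (d : ℚ)).toAffine.Point = ⊥ := by
  have hm' : 0 < m ∧ ¬ (3 : ℤ) ∣ m := by
    simp only [Set.mem_insert_iff, Set.mem_singleton_iff] at hm
    omega
  obtain ⟨g⟩ := TwistTorsion.nonempty_goodAtThree (n := n) hs (by omega) hm'.2 hd0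
    (hd12.of_dvd (by norm_num))
  exact g.torsion_eq_bot
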